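/- For a set $Y$ and collections $\mathscr{A},\mathscr{B}$ of families of subsets of $Y$, say that $S_1(\mathscr{A},\mathscr{B})$ holds if for all $\mathcal{U}_1,\mathcal{U}_2,\dots\in\mathscr{A}$ there are $U_1\in\mathcal{U}_1,U_2\in\mathcal{U}_2,\dots$ such that $\{U_n : n\in\mathbb{N}\}\in\mathscr{B}$, and that $S_{fin}(\mathscr{A},\mathscr{B})$ holds if for all $\mathcal{U}_1,\mathcal{U}_2,\dots\in\mathscr{A}$ there are finite $\mathcal{F}_1\subseteq\mathcal{U}_1,\mathcal{F}_2\subseteq\mathcal{U}_2,\dots$ such that $\bigcup_n\mathcal{F}_n\in\mathscr{B}$. For a topological space $Y$, let $\mathrm{D}$ be the collection of all families of subsets of $Y$ whose union is dense in $Y$; let $\mathrm{D}_o$ be the collection of all families in $\mathrm{D}$ all of whose members are open; let $\mathrm{O}$ be the collection of all open covers of $Y$; and let $\Omega$ be the collection of all open covers $\mathcal{U}$ of $Y$ such that every finite subset of $Y$ is contained in some member of $\mathcal{U}$ and $Y\notin\mathcal{U}$. We consider the eight properties $$S_{fin}(\mathrm{D},\mathrm{D}),\ S_{fin}(\mathrm{D}_o,\mathrm{D}),\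 S_{fin}(\mathrm{O},\mathrm{D}),\ S_{fin}(\mathrm{O},\mathrm{O}),\ S_1(\mathrm{D},\mathrm{D}),\ S_1(\mathrm{D}_o,\mathrm{D}),\ S_1(\mathrm{O},\mathrm{D}),\ S_1(\mathrm{O},\mathrm{O}).$$ For a topological space $X$, the Pixley--Roy space $\mathrm{PR}(X)$ is the space of all nonempty finite subsets of $X$, with the topology generated by the sets $[F,U]=\{H\in\mathrm{PR}(X) : F\subseteq H\subseteq U\}$, where $F\in\mathrm{PR}(X)$ and $U$ is open in $X$. Theorem. Let $X$ be an uncountable separable metrizable space. 1. If $X$ satisfies $S_1(\Omega,\Omega)$, then, of the eight properties, $\mathrm{PR}(X)$ satisfies exactly $S_{fin}(\mathrm{D}_o,\mathrm{D})$, $S_{fin}(\mathrm{O},\mathrm{D})$, $S_1(\mathrm{D}_o,\mathrm{D})$ and $S_1(\mathrm{O},\mathrm{D})$. 2. If $X$ does not satisfy $S_{fin}(\Omega,\Omega)$, then $\mathrm{PR}(X)$ satisfies none of the eight properties. 3. If $X$ satisfies $S_{fin}(\Omega,\Omega)$ but not $S_1(\Omega,\Omega)$, then, of the eight properties, $\mathrm{PR}(X)$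 satisfies exactly $S_{fin}(\mathrm{D}_o,\mathrm{D})$ and $S_{fin}(\mathrm{O},\mathrm{D})$. Moreover, the space $X=\mathbb{R}$ satisfies $S_{fin}(\Omega,\Omega)$ but not $S_1(\Omega,\Omega)$, so that 3 applies to it. -/

import Mathlib

open Set

/-- `S₁(𝒜, ℬ)`: from every sequence of members of `𝒜` one can pick one element each,
so that the set of the elements picked belongs to `ℬ`. -/
def SelOne {Y : Type*} (𝒜 ℬ : Set (Set Y)) : Prop :=
  ∀ 𝒰 : ℕ → Set Y, (∀ n, 𝒰 n ∈ 𝒜) →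
    ∃ V : ℕ → Y, (∀ n, V n ∈ 𝒰 n) ∧ Set.range V ∈ ℬ

/-- `S_fin(𝒜, ℬ)`: from every sequence of members of `𝒜` one can pick finitely many elements
each, so that the set of all the elements picked belongs to `ℬ`. -/
def SelFin {Y : Type*} (𝒜 ℬ : Set (Set Y)) : Prop :=
  ∀ 𝒰 : ℕ → Set Y, (∀ n, 𝒰 n ∈ 𝒜) →
    ∃ F : ℕ → Set Y, (∀ n, F n ⊆ 𝒰 n ∧ (F n).Finite) ∧ (⋃ n, F n) ∈ ℬ

/-- `D`: the families of subsets of `X` with dense union. -/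
def denseFamilies (X : Type*) [TopologicalSpace X] : Set (Set (Set X)) :=
  {𝒰 | Dense (⋃₀ 𝒰)}

/-- `Do`: the families of open subsets of `X` with dense union. -/
def denseOpenFamilies (X : Type*) [TopologicalSpace X] : Set (Set (Set X)) :=
  {𝒰 | Dense (⋃₀ 𝒰) ∧ ∀ U ∈ 𝒰, IsOpen U}

/-- `Op`: the open covers of `X`. -/
def openCovers (X : Type*) [TopologicalSpace X] : Set (Set (Set X)) :=
  {𝒰 | ⋃₀ 𝒰 = Set.univ ∧ ∀ U ∈ 𝒰, IsOpen U}

/-- `Ω`: the open covers of `X` such that every finite subset of `X` is contained in some member,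
and `X` itself is not a member. -/
def omegaCovers (X : Type*) [TopologicalSpace X] : Set (Set (Set X)) :=
  {𝒰 | 𝒰 ∈ openCovers X ∧ (∀ F : Set X, F.Finite → ∃ U ∈ 𝒰, F ⊆ U) ∧ Set.univ ∉ 𝒰}

/-- The points of the Pixley–Roy space over `X`: the nonempty finite subsets of `X`. -/
def PixleyRoy (X : Type*) : Type _ := {F : Set X // F.Finite ∧ F.Nonempty}

/-- The basic set `[F, U] = {H | F ⊆ H ⊆ U}`. -/
def PixleyRoy.basicSet {X : Type*} (F : PixleyRoy X) (U : Set X) : Set (PixleyRoy X) :=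
  {H | F.1 ⊆ H.1 ∧ H.1 ⊆ U}

/-- The Pixley–Roy topology, generated by the sets `[F, U]` with `U` open. -/
instance PixleyRoy.instTopologicalSpace {X : Type*} [TopologicalSpace X] :
    TopologicalSpace (PixleyRoy X) :=
  TopologicalSpace.generateFrom
    {S | ∃ (F : PixleyRoy X) (U : Set X), IsOpen U ∧ S = PixleyRoy.basicSet F U}

/-!
The eight properties fall into three groups.

* `S_fin(D, D)` and `S_fin(O, O)`, hence also their `S₁` versions, fail for every uncountable `X`:
  the first would make `PR(X)` separable, the second would give the cover by the sets `[{x}, X]`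
  a countable subcover, and in both cases countably many finite sets would exhaust `X`.
* `S(Dₒ, D)`, `S(O, D)` for `PR(X)` and `S(Ω, Ω)` for `X` are equivalent, for `S = S_fin` as well as
  for `S = S₁`. An ω-cover `𝒰` of `X` gives the open cover `{[F, U] : U ∈ 𝒰}` of `PR(X)`, and
  density of a selection means that every `[H, X]` meets some chosen `[F, U]`, which forces `H ⊆ U`
  (`SelSize.omegaCovers_of_openCovers`). Conversely, let `𝒰` be a family of open sets with dense
  union in `PR(X)`, and let `C ⊆ U` with `C` closed and `U` open. The open `V ⊆ U` with some
  `[G, V]` inside a member of `𝒰` contain all finite subsets of `U`, so the sets `V ∪ Cᶜ` form an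
  ω-cover of `X`, unless one `V` contains `C` and already suffices. If `H ⊆ C` lies in `V`, then
  `G ∪ H` lies in `[G, V] ∩ [H, U]`, so a selection from these ω-covers meets all `[H, U]` with
  `H ⊆ C` (`SelSize.exists_meeting_selection`). Countably many pairs `(C, U)` suffice for density
  (`exists_seq_isClosed_subset_isOpen`), and the sequence of families is split accordingly
  (`SelSize.denseOpenFamilies_of_omegaCovers`).
* For `X = ℝ`, the compact cubes `[-n, n]ⁿ` yield `S_fin(Ω, Ω)`, while the ω-covers by the open sets
  of measure less than `εₙ`, where `∑ εₙ < 1`, refute `S₁(Ω, Ω)`.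
-/

universe u

/-! ### A common form of the two selection principles -/

/-- A notion of smallness of sets that contains the singletons and is preserved by images;
finiteness and being a singleton are the two instances of interest. -/
structure IsSizeNotion (p : ∀ ⦃Y : Type u⦄, Set Y → Prop) : Prop where
  singleton : ∀ ⦃Y : Type u⦄ (y : Y), p {y}
  image : ∀ ⦃Y Z : Type u⦄ (f : Y → Z) (s : Set Y), p s → p (f '' s)

/-- From every sequence of members of `𝒜` one can pick subsets of size `p` whose union is in `ℬ`. -/
def SelSize (p : ∀ ⦃Y : Type u⦄, Set Y → Prop) {Y : Type u} (𝒜 ℬ : Set (Set Y)) : Prop :=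
  ∀ 𝒰 : ℕ → Set Y, (∀ n, 𝒰 n ∈ 𝒜) →
    ∃ F : ℕ → Set Y, (∀ n, F n ⊆ 𝒰 n ∧ p (F n)) ∧ (⋃ n, F n) ∈ ℬ

theorem isSizeNotion_finite : IsSizeNotion.{u} (fun _ s => s.Finite) :=
  ⟨fun _ y => Set.finite_singleton y, fun _ _ f _ h => h.image f⟩

theorem isSizeNotion_singleton : IsSizeNotion.{u} (fun _ s => ∃ a, s = {a}) := by
  refine ⟨fun _ y => ⟨y, rfl⟩, ?_⟩
  rintro Y Z f _ ⟨a, rfl⟩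
  exact ⟨f a, Set.image_singleton⟩

theorem selOne_iff_selSize {Y : Type u} {𝒜 ℬ : Set (Set Y)} :
    SelOne 𝒜 ℬ ↔ SelSize (fun _ s => ∃ a, s = {a}) 𝒜 ℬ := by
  constructor
  · intro h 𝒰 h𝒰
    obtain ⟨V, hV, hB⟩ := h 𝒰 h𝒰
    refine ⟨fun n => {V n}, fun n => ⟨Set.singleton_subset_iff.2 (hV n), V n, rfl⟩, ?_⟩
    rwa [Set.iUnion_singleton_eq_range]
  · intro h 𝒰 h𝒰
    obtain ⟨F, hF, hB⟩ := h 𝒰 h𝒰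
    choose hsub V hV using hF
    refine ⟨V, fun n => hsub n (by simp [hV n]), ?_⟩
    rw [← Set.iUnion_singleton_eq_range]
    simpa only [← hV] using hB

theorem SelOne.selFin {Y : Type u} {𝒜 ℬ : Set (Set Y)} (h : SelOne 𝒜 ℬ) : SelFin 𝒜 ℬ := by
  intro 𝒰 h𝒰
  obtain ⟨F, hF, hB⟩ := selOne_iff_selSize.1 h 𝒰 h𝒰
  refine ⟨F, fun n => ⟨(hF n).1, ?_⟩, hB⟩
  obtain ⟨a, ha⟩ := (hF n).2
  simp [ha]

theorem SelSize.mono_left {p : ∀ ⦃Y : Type u⦄, Set Y → Prop} {Y : Type u}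
    {𝒜 𝒜' ℬ : Set (Set Y)} (h : SelSize p 𝒜 ℬ) (h𝒜 : 𝒜' ⊆ 𝒜) : SelSize p 𝒜' ℬ :=
  fun 𝒰 h𝒰 => h 𝒰 fun n => h𝒜 (h𝒰 n)

theorem openCovers_subset_denseOpenFamilies (X : Type*) [TopologicalSpace X] :
    openCovers X ⊆ denseOpenFamilies X := by
  rintro 𝒰 ⟨h, ho⟩
  exact ⟨h ▸ dense_univ, ho⟩

/-! ### The Pixley–Roy space -/

namespace PixleyRoy

variable {X : Type u}

/-- The one-point set `{x}` as a point of the Pixley–Roy space. -/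
def single (x : X) : PixleyRoy X := ⟨{x}, Set.finite_singleton x, Set.singleton_nonempty x⟩

/-- The union of two nonempty finite sets. -/
def union (F H : PixleyRoy X) : PixleyRoy X :=
  ⟨F.1 ∪ H.1, F.2.1.union H.2.1, F.2.2.inl⟩

theorem isOpen_basicSet [TopologicalSpace X] (F : PixleyRoy X) {U : Set X} (hU : IsOpen U) :
    IsOpen (basicSet F U) :=
  TopologicalSpace.isOpen_generateFrom_of_mem ⟨F, U, hU, rfl⟩

theorem exists_basicSet_subset [TopologicalSpace X] {O : Set (PixleyRoy X)} (hO : IsOpen O)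
    {H : PixleyRoy X} (hH : H ∈ O) :
    ∃ U, IsOpen U ∧ H.1 ⊆ U ∧ basicSet H U ⊆ O := by
  induction hO with
  | basic s hs =>
    obtain ⟨F, U, hU, rfl⟩ := hs
    exact ⟨U, hU, hH.2, fun K hK => ⟨hH.1.trans hK.1, hK.2⟩⟩
  | univ => exact ⟨Set.univ, isOpen_univ, Set.subset_univ _, Set.subset_univ _⟩
  | inter s t _ _ ihs iht =>
    obtain ⟨U, hU, hHU, hs⟩ := ihs hH.1
    obtain ⟨V, hV, hHV, ht⟩ := iht hH.2
    exact ⟨U ∩ V, hU.inter hV, Set.subset_inter hHU hHV, fun K hK =>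
      ⟨hs ⟨hK.1, hK.2.trans Set.inter_subset_left⟩, ht ⟨hK.1, hK.2.trans Set.inter_subset_right⟩⟩⟩
  | sUnion S _ ih =>
    obtain ⟨s, hs, hHs⟩ := hH
    obtain ⟨U, hU, hHU, hsub⟩ := ih s hs hHs
    exact ⟨U, hU, hHU, hsub.trans (Set.subset_sUnion_of_mem hs)⟩

theorem exists_forall_notMem_of_countable [Uncountable X] {S : Set (PixleyRoy X)}
    (hS : S.Countable) : ∃ x : X, ∀ H ∈ S, x ∉ H.1 := by
  have hc : (⋃ H ∈ S, H.1).Countable := hS.biUnion fun H _ => H.2.1.countable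
  obtain ⟨x, hx⟩ := (Set.ne_univ_iff_exists_notMem _).1 fun h =>
    Set.not_countable_univ (α := X) (h ▸ hc)
  exact ⟨x, fun H hH hxH => hx (Set.mem_biUnion hH hxH)⟩

theorem not_selFin_denseFamilies [TopologicalSpace X] [Uncountable X] :
    ¬ SelFin (denseFamilies (PixleyRoy X)) (denseFamilies (PixleyRoy X)) := by
  intro h
  obtain ⟨F, hF, hD⟩ := h (fun _ => Set.range fun H : PixleyRoy X => ({H} : Set (PixleyRoy X)))
    (fun _ => by
      have : ⋃₀ (Set.range fun H : PixleyRoy X => ({H} : Set (PixleyRoy X))) = Set.univ := by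
        ext H; simp
      exact Dense.mono this.ge dense_univ)
  have hc : (⋃₀ ⋃ n, F n).Countable := by
    refine Set.Countable.sUnion (Set.countable_iUnion fun n => (hF n).2.countable) ?_
    intro s hs
    obtain ⟨n, hn⟩ := Set.mem_iUnion.1 hs
    obtain ⟨H, rfl⟩ := (hF n).1 hn
    exact Set.countable_singleton H
  obtain ⟨x, hx⟩ := exists_forall_notMem_of_countable hc
  obtain ⟨H, hH, hHS⟩ := Dense.inter_open_nonempty hD _
    (isOpen_basicSet (single x) isOpen_univ) ⟨single x, subset_rfl, Set.subset_univ _⟩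
  exact hx H hHS (hH.1 rfl)

theorem not_selFin_openCovers [TopologicalSpace X] [Uncountable X] :
    ¬ SelFin (openCovers (PixleyRoy X)) (openCovers (PixleyRoy X)) := by
  intro h
  obtain ⟨F, hF, hO, -⟩ := h (fun _ => Set.range fun x : X => basicSet (single x) Set.univ)
    (fun _ => by
      refine ⟨Set.eq_univ_of_forall fun H => ?_, ?_⟩
      · obtain ⟨x, hx⟩ := H.2.2
        exact ⟨_, ⟨x, rfl⟩, Set.singleton_subset_iff.2 hx, Set.subset_univ _⟩
      · rintro _ ⟨x, rfl⟩
        exact isOpen_basicSet _ isOpen_univ)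
  choose! c hc using fun n S (hS : S ∈ F n) => (hF n).1 hS
  have hS : (⋃ n, (fun s => single (c n s)) '' F n).Countable :=
    Set.countable_iUnion fun n => ((hF n).2.image _).countable
  obtain ⟨x, hx⟩ := exists_forall_notMem_of_countable hS
  obtain ⟨s, hs, hxs⟩ : single x ∈ ⋃₀ ⋃ n, F n := hO ▸ Set.mem_univ _
  obtain ⟨n, hn⟩ := Set.mem_iUnion.1 hs
  rw [← hc n s hn] at hxs
  have hcx : c n s = x := hxs.1 rfl
  exact hx _ (Set.mem_iUnion.2 ⟨n, s, hn, rfl⟩) hcx.symm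

end PixleyRoy

/-! ### From the Pixley–Roy space to ω-covers -/

/-- Only the sets `U` of the chosen `[F, U]` matter; the points `F` are discarded. -/
theorem SelSize.omegaCovers_of_openCovers {p : ∀ ⦃Y : Type u⦄, Set Y → Prop}
    (hp : IsSizeNotion p) {X : Type u} [TopologicalSpace X] [Nonempty X]
    (h : SelSize p (openCovers (PixleyRoy X)) (denseFamilies (PixleyRoy X))) :
    SelSize p (omegaCovers X) (omegaCovers X) := by
  intro 𝒰 h𝒰
  obtain ⟨𝒢, h𝒢, hD⟩ := h
    (fun n => {S | ∃ F : PixleyRoy X, ∃ U ∈ 𝒰 n, S = PixleyRoy.basicSet F U}) (fun n => by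
      refine ⟨Set.eq_univ_of_forall fun H => ?_, ?_⟩
      · obtain ⟨U, hU, hHU⟩ := (h𝒰 n).2.1 H.1 H.2.1
        exact ⟨_, ⟨H, U, hU, rfl⟩, subset_rfl, hHU⟩
      · rintro _ ⟨F, U, hU, rfl⟩
        exact PixleyRoy.isOpen_basicSet F ((h𝒰 n).1.2 U hU))
  choose! c u hu hc using fun n S (hS : S ∈ 𝒢 n) => (h𝒢 n).1 hS
  have hcov : ∀ H : PixleyRoy X, ∃ n, ∃ S ∈ 𝒢 n, H.1 ⊆ u n S := by
    intro H
    obtain ⟨K, hK, S, hS, hKS⟩ := Dense.inter_open_nonempty hD _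
      (PixleyRoy.isOpen_basicSet H isOpen_univ) ⟨H, subset_rfl, Set.subset_univ _⟩
    obtain ⟨n, hn⟩ := Set.mem_iUnion.1 hS
    rw [hc n S hn] at hKS
    exact ⟨n, S, hn, hK.1.trans hKS.2⟩
  have hsub : ∀ n, u n '' 𝒢 n ⊆ 𝒰 n := by
    rintro n _ ⟨S, hS, rfl⟩
    exact hu n S hS
  refine ⟨fun n => u n '' 𝒢 n, fun n => ⟨hsub n, hp.image _ _ (h𝒢 n).2⟩, ⟨?_, ?_⟩, ?_, ?_⟩
  · refine Set.eq_univ_of_forall fun x => ?_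
    obtain ⟨n, S, hS, hx⟩ := hcov (PixleyRoy.single x)
    exact ⟨u n S, Set.mem_iUnion.2 ⟨n, S, hS, rfl⟩, hx rfl⟩
  · intro U hU
    obtain ⟨n, hn⟩ := Set.mem_iUnion.1 hU
    exact (h𝒰 n).1.2 U (hsub n hn)
  · intro F hF
    -- An added point makes `F` nonempty.
    obtain ⟨x⟩ := ‹Nonempty X›
    obtain ⟨n, S, hS, hx⟩ := hcov ⟨insert x F, hF.insert x, Set.insert_nonempty x F⟩
    exact ⟨u n S, Set.mem_iUnion.2 ⟨n, S, hS, rfl⟩, (Set.subset_insert x F).trans hx⟩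
  · intro hU
    obtain ⟨n, hn⟩ := Set.mem_iUnion.1 hU
    exact (h𝒰 n).2.2 (hsub n hn)

/-! ### From ω-covers to the Pixley–Roy space -/

/-- The space is only assumed to have `S(Ω, Ω)` itself, not its open subsets; the closed set `C`
makes up for this, since the sets `V ∪ Cᶜ` cover all of `X`. -/
theorem SelSize.exists_meeting_selection {p : ∀ ⦃Y : Type u⦄, Set Y → Prop}
    (hp : IsSizeNotion p) {X : Type u} [TopologicalSpace X] [Nonempty X]
    (h : SelSize p (omegaCovers X) (omegaCovers X)) {C U : Set X} (hC : IsClosed C)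
    (hU : IsOpen U) (hCU : C ⊆ U) {𝒰 : ℕ → Set (Set (PixleyRoy X))}
    (h𝒰 : ∀ n, 𝒰 n ∈ denseOpenFamilies (PixleyRoy X)) :
    ∃ F : ℕ → Set (Set (PixleyRoy X)), (∀ n, F n ⊆ 𝒰 n ∧ p (F n)) ∧
      ∀ H : PixleyRoy X, H.1 ⊆ C →
        ∃ n, ∃ W ∈ F n, (W ∩ PixleyRoy.basicSet H U).Nonempty := by
  let Good : ℕ → Set X → Set (PixleyRoy X) → Prop := fun n V W =>
    IsOpen V ∧ V ⊆ U ∧ W ∈ 𝒰 n ∧ ∃ G : PixleyRoy X, G.1 ⊆ V ∧ PixleyRoy.basicSet G V ⊆ W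
  have hgood : ∀ n, ∀ H : PixleyRoy X, H.1 ⊆ U → ∃ V W, Good n V W ∧ H.1 ⊆ V := by
    intro n H hH
    obtain ⟨G, hG, W, hW, hGW⟩ := (h𝒰 n).1.inter_open_nonempty _
      (PixleyRoy.isOpen_basicSet H hU) ⟨H, subset_rfl, hH⟩
    obtain ⟨V, hV, hGV, hsub⟩ := PixleyRoy.exists_basicSet_subset ((h𝒰 n).2 W hW) hGW
    exact ⟨V ∩ U, W, ⟨hV.inter hU, Set.inter_subset_right, hW, G, Set.subset_inter hGV hG.2,
      fun K hK => hsub ⟨hK.1, hK.2.trans Set.inter_subset_left⟩⟩,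
      hG.1.trans (Set.subset_inter hGV hG.2)⟩
  have hmeet : ∀ n V W, Good n V W → ∀ H : PixleyRoy X, H.1 ⊆ V →
      (W ∩ PixleyRoy.basicSet H U).Nonempty := by
    rintro n V W ⟨-, hVU, -, G, hGV, hGW⟩ H hH
    exact ⟨G.union H, hGW ⟨Set.subset_union_left, Set.union_subset hGV hH⟩,
      Set.subset_union_right, (Set.union_subset hGV hH).trans hVU⟩
  have hne : ∀ n, ∃ W, W ∈ 𝒰 n := by
    intro n
    obtain ⟨x⟩ := ‹Nonempty X›
    have : Nonempty (PixleyRoy X) := ⟨PixleyRoy.single x⟩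
    obtain ⟨K, W, hW, -⟩ := (h𝒰 n).1.nonempty
    exact ⟨W, hW⟩
  choose W₀ hW₀ using hne
  rcases C.eq_empty_or_nonempty with rfl | ⟨c, hc⟩
  · exact ⟨fun n => {W₀ n}, fun n => ⟨Set.singleton_subset_iff.2 (hW₀ n), hp.singleton _⟩,
      fun H hH => absurd (H.2.2.mono hH) Set.not_nonempty_empty⟩
  by_cases hbig : ∃ m V W, Good m V W ∧ C ⊆ V
  -- One member of one family already suffices; the other choices are irrelevant.
  · obtain ⟨m, V, W, hVW, hCV⟩ := hbig
    refine ⟨fun n => {Function.update W₀ m W n}, fun n => ⟨?_, hp.singleton _⟩,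
      fun H hH => ⟨m, W, by simp, hmeet m V W hVW H (hH.trans hCV)⟩⟩
    rw [Set.singleton_subset_iff]
    rcases eq_or_ne n m with rfl | hnm
    · simpa using hVW.2.2.1
    · simpa [hnm] using hW₀ n
  obtain ⟨𝒮, h𝒮, hΩ⟩ := h (fun n => {S | ∃ V W, Good n V W ∧ S = V ∪ Cᶜ}) (fun n => by
    have hfin : ∀ F : Set X, F.Finite → ∃ S ∈ {S | ∃ V W, Good n V W ∧ S = V ∪ Cᶜ}, F ⊆ S := by
      intro F hF
      obtain ⟨V, W, hVW, hFV⟩ := hgood n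
        ⟨insert c (F ∩ C), (hF.inter_of_left C).insert c, Set.insert_nonempty _ _⟩
        (Set.insert_subset (hCU hc) (Set.inter_subset_right.trans hCU))
      refine ⟨V ∪ Cᶜ, ⟨V, W, hVW, rfl⟩, fun x hx => ?_⟩
      by_cases hxC : x ∈ C
      · exact Or.inl (hFV (Set.mem_insert_of_mem _ ⟨hx, hxC⟩))
      · exact Or.inr hxC
    refine ⟨⟨Set.eq_univ_of_forall fun x => ?_, ?_⟩, hfin, ?_⟩
    · obtain ⟨S, hS, hx⟩ := hfin {x} (Set.finite_singleton x)
      exact ⟨S, hS, hx rfl⟩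
    · rintro _ ⟨V, W, hVW, rfl⟩
      exact hVW.1.union hC.isOpen_compl
    · rintro ⟨V, W, hVW, hS⟩
      refine hbig ⟨n, V, W, hVW, fun x hx => ?_⟩
      rcases (hS ▸ Set.mem_univ x : x ∈ V ∪ Cᶜ) with hV | hx'
      exacts [hV, absurd hx hx'])
  choose! v w hvw hv using fun n S (hS : S ∈ 𝒮 n) => (h𝒮 n).1 hS
  refine ⟨fun n => w n '' 𝒮 n, fun n => ⟨?_, hp.image _ _ (h𝒮 n).2⟩, fun H hH => ?_⟩
  · rintro _ ⟨S, hS, rfl⟩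
    exact (hvw n S hS).2.2.1
  · obtain ⟨S, hS, hHS⟩ := hΩ.2.1 H.1 H.2.1
    obtain ⟨n, hn⟩ := Set.mem_iUnion.1 hS
    refine ⟨n, w n S, ⟨S, hn, rfl⟩, hmeet n _ _ (hvw n S hn) H fun x hx => ?_⟩
    rcases (hv n S hn ▸ hHS hx : x ∈ v n S ∪ Cᶜ) with hV | hx'
    exacts [hV, absurd (hH hx) hx']

theorem exists_seq_isClosed_subset_isOpen (X : Type*) [TopologicalSpace X]
    [TopologicalSpace.SeparableSpace X] [TopologicalSpace.MetrizableSpace X] :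
    ∃ C U : ℕ → Set X, (∀ n, IsClosed (C n) ∧ IsOpen (U n) ∧ C n ⊆ U n) ∧
      ∀ F : Set X, F.Finite → ∀ O, IsOpen O → F ⊆ O → ∃ n, F ⊆ C n ∧ U n ⊆ O := by
  let := TopologicalSpace.metrizableSpaceMetric X
  have := UniformSpace.secondCountable_of_separable X
  let b := TopologicalSpace.countableBasis X
  have hb := TopologicalSpace.isBasis_countableBasis X
  let ι := {s : Set (Set X) | s.Finite ∧ s ⊆ b}
  have : Countable ι :=
    (Set.countable_ofPred_finite_subset (TopologicalSpace.countable_countableBasis X)).to_subtype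
  have : Nonempty ι := ⟨⟨∅, Set.finite_empty, Set.empty_subset _⟩⟩
  have hopen : ∀ s : ι, IsOpen (⋃₀ s.1) := fun s => isOpen_sUnion fun t ht => hb.isOpen (s.2.2 ht)
  choose K hKc hKsub hKU hKmono using fun s : ι => (hopen s).exists_iUnion_isClosed
  obtain ⟨e, he⟩ := exists_surjective_nat (ι × ℕ)
  refine ⟨fun n => K (e n).1 (e n).2, fun n => ⋃₀ (e n).1.1,
    fun n => ⟨hKc _ _, hopen _, hKsub _ _⟩, fun F hF O hO hFO => ?_⟩
  choose! t ht hxt htO using fun x (hx : x ∈ F) => hb.exists_subset_of_mem_open (hFO hx) hO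
  let s : ι := ⟨t '' F, hF.image t, by rintro _ ⟨x, hx, rfl⟩; exact ht x hx⟩
  have hFs : ∀ x ∈ F, ∃ k, x ∈ K s k := fun x hx => by
    rw [← Set.mem_iUnion, hKU]
    exact ⟨t x, ⟨x, hx, rfl⟩, hxt x hx⟩
  choose! k hk using hFs
  obtain ⟨N, hN⟩ := (hF.image k).bddAbove
  obtain ⟨n, hn⟩ := he (s, N)
  refine ⟨n, fun x hx => ?_, ?_⟩
  · simp only [hn]
    exact hKmono s (hN ⟨x, hx, rfl⟩) (hk x hx)
  · simp only [hn]
    rintro y ⟨_, ⟨x, hx, rfl⟩, hy⟩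
    exact htO x hx hy

theorem SelSize.denseOpenFamilies_of_omegaCovers {p : ∀ ⦃Y : Type u⦄, Set Y → Prop}
    (hp : IsSizeNotion p) {X : Type u} [TopologicalSpace X] [TopologicalSpace.SeparableSpace X]
    [TopologicalSpace.MetrizableSpace X] [Nonempty X]
    (h : SelSize p (omegaCovers X) (omegaCovers X)) :
    SelSize p (denseOpenFamilies (PixleyRoy X)) (denseFamilies (PixleyRoy X)) := by
  intro 𝒰 h𝒰
  obtain ⟨C, U, hCU, hex⟩ := exists_seq_isClosed_subset_isOpen X
  choose F hF hmeet using fun j => h.exists_meeting_selection hp (hCU j).1 (hCU j).2.1 (hCU j).2.2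
    (𝒰 := fun n => 𝒰 (Nat.pair j n)) (fun n => h𝒰 _)
  refine ⟨fun m => F m.unpair.1 m.unpair.2, fun m => ?_, dense_iff_inter_open.2 ?_⟩
  · simpa using hF m.unpair.1 m.unpair.2
  · rintro O hO ⟨H, hH⟩
    obtain ⟨V, hV, hHV, hVO⟩ := PixleyRoy.exists_basicSet_subset hO hH
    obtain ⟨j, hHC, hUV⟩ := hex H.1 H.2.1 V hV hHV
    obtain ⟨n, W, hW, K, hKW, hK⟩ := hmeet j H hHC
    exact ⟨K, hVO ⟨hK.1, hK.2.trans hUV⟩, W,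
      Set.mem_iUnion.2 ⟨Nat.pair j n, by simpa using hW⟩, hKW⟩

/-! ### The real line -/

theorem selFin_omegaCovers_real : SelFin (omegaCovers ℝ) (omegaCovers ℝ) := by
  intro 𝒰 h𝒰
  have hcube : ∀ n : ℕ, ∃ T ⊆ 𝒰 n, T.Finite ∧
      (Set.univ.pi fun _ : Fin n => Set.Icc (-n : ℝ) n) ⊆ ⋃ V ∈ T, Set.univ.pi fun _ => V := by
    intro n
    have hc : IsCompact (Set.univ.pi fun _ : Fin n => Set.Icc (-n : ℝ) n) :=
      isCompact_univ_pi fun _ => isCompact_Icc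
    refine hc.elim_finite_subcover_image
      (fun V hV => isOpen_set_pi Set.finite_univ fun _ _ => (h𝒰 n).1.2 V hV) fun f _ => ?_
    obtain ⟨V, hV, hfV⟩ := (h𝒰 n).2.1 (Set.range f) (Set.finite_range f)
    exact Set.mem_biUnion hV fun i _ => hfV ⟨i, rfl⟩
  choose T hT hTfin hTcov using hcube
  have hfin : ∀ F : Set ℝ, F.Finite → ∃ V ∈ ⋃ n, T n, F ⊆ V := by
    intro F hF
    -- With `0` added, `F` is the range of a function on `Fin n` for each large `n`.
    have hF' : (insert 0 F).Finite := hF.insert 0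
    obtain ⟨R, hR⟩ := (hF'.image fun x => |x|).bddAbove
    obtain ⟨m, hm⟩ := exists_nat_ge R
    obtain ⟨k, g, hg⟩ := hF'.fin_embedding
    let n := max m k
    let f : Fin n → ℝ := fun i => if h : i.1 < k then g ⟨i.1, h⟩ else 0
    have hfF : ∀ i, f i ∈ insert 0 F := by
      intro i
      by_cases h : i.1 < k
      · simp only [f, h, dite_true]
        exact hg ▸ Set.mem_range_self _
      · simp [f, h]
    have hf : f ∈ Set.univ.pi fun _ : Fin n => Set.Icc (-n : ℝ) n := by
      intro i _
      have h1 : |f i| ≤ R := hR ⟨f i, hfF i, rfl⟩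
      have h2 : (m : ℝ) ≤ n := by exact_mod_cast le_max_left m k
      exact abs_le.1 (h1.trans (hm.trans h2))
    obtain ⟨V, hV, hfV⟩ := Set.mem_iUnion₂.1 (hTcov n hf)
    refine ⟨V, Set.mem_iUnion.2 ⟨n, hV⟩, fun x hx => ?_⟩
    obtain ⟨j, rfl⟩ : x ∈ Set.range g := hg ▸ Set.mem_insert_of_mem 0 hx
    simpa [f] using hfV ⟨j.1, j.2.trans_le (le_max_right m k)⟩ (Set.mem_univ _)
  refine ⟨T, fun n => ⟨hT n, hTfin n⟩, ⟨Set.eq_univ_of_forall fun x => ?_, ?_⟩, hfin, ?_⟩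
  · obtain ⟨V, hV, hx⟩ := hfin {x} (Set.finite_singleton x)
    exact ⟨V, hV, hx rfl⟩
  · intro V hV
    obtain ⟨n, hn⟩ := Set.mem_iUnion.1 hV
    exact (h𝒰 n).1.2 V (hT n hn)
  · intro hV
    obtain ⟨n, hn⟩ := Set.mem_iUnion.1 hV
    exact (h𝒰 n).2.2 (hT n hn)

theorem not_selOne_omegaCovers_real : ¬ SelOne (omegaCovers ℝ) (omegaCovers ℝ) := by
  intro h
  obtain ⟨ε, hε, hsum⟩ := ENNReal.exists_pos_sum_of_countable one_ne_zero ℕ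
  obtain ⟨V, hV, hcov⟩ := h (fun n => {V | IsOpen V ∧ MeasureTheory.volume V < ε n}) (fun n => by
    have hfin : ∀ F : Set ℝ, F.Finite →
        ∃ V ∈ {V : Set ℝ | IsOpen V ∧ MeasureTheory.volume V < ε n}, F ⊆ V := by
      intro F hF
      obtain ⟨V, hFV, hV, hlt⟩ := F.exists_isOpen_lt_of_lt (μ := MeasureTheory.volume) (ε n)
        (by simpa [hF.measure_zero] using hε n)
      exact ⟨V, ⟨hV, hlt⟩, hFV⟩
    refine ⟨⟨Set.eq_univ_of_forall fun x => ?_, fun V hV => hV.1⟩, hfin, fun hV => ?_⟩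
    · obtain ⟨V, hV, hx⟩ := hfin {x} (Set.finite_singleton x)
      exact ⟨V, hV, hx rfl⟩
    · simpa using hV.2)
  have h1 : MeasureTheory.volume (⋃ n, V n) ≤ 1 :=
    (MeasureTheory.measure_iUnion_le V).trans
      ((ENNReal.tsum_le_tsum fun n => (hV n).2.le).trans hsum.le)
  have h2 : ⋃ n, V n = Set.univ := by
    rw [← Set.sUnion_range]
    exact hcov.1.1
  simp [h2] at h1

theorem mainTheorem7 :
    (∀ (X : Type*) [TopologicalSpace X] [TopologicalSpace.SeparableSpace X]
        [TopologicalSpace.MetrizableSpace X] [Uncountable X],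
      (SelOne (omegaCovers X) (omegaCovers X) →
        ¬ SelFin (denseFamilies (PixleyRoy X)) (denseFamilies (PixleyRoy X)) ∧
        SelFin (denseOpenFamilies (PixleyRoy X)) (denseFamilies (PixleyRoy X)) ∧
        SelFin (openCovers (PixleyRoy X)) (denseFamilies (PixleyRoy X)) ∧
        ¬ SelFin (openCovers (PixleyRoy X)) (openCovers (PixleyRoy X)) ∧
        ¬ SelOne (denseFamilies (PixleyRoy X)) (denseFamilies (PixleyRoy X)) ∧
        SelOne (denseOpenFamilies (PixleyRoy X)) (denseFamilies (PixleyRoy X)) ∧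
        SelOne (openCovers (PixleyRoy X)) (denseFamilies (PixleyRoy X)) ∧
        ¬ SelOne (openCovers (PixleyRoy X)) (openCovers (PixleyRoy X))) ∧
      (¬ SelFin (omegaCovers X) (omegaCovers X) →
        ¬ SelFin (denseFamilies (PixleyRoy X)) (denseFamilies (PixleyRoy X)) ∧
        ¬ SelFin (denseOpenFamilies (PixleyRoy X)) (denseFamilies (PixleyRoy X)) ∧
        ¬ SelFin (openCovers (PixleyRoy X)) (denseFamilies (PixleyRoy X)) ∧
        ¬ SelFin (openCovers (PixleyRoy X)) (openCovers (PixleyRoy X)) ∧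
        ¬ SelOne (denseFamilies (PixleyRoy X)) (denseFamilies (PixleyRoy X)) ∧
        ¬ SelOne (denseOpenFamilies (PixleyRoy X)) (denseFamilies (PixleyRoy X)) ∧
        ¬ SelOne (openCovers (PixleyRoy X)) (denseFamilies (PixleyRoy X)) ∧
        ¬ SelOne (openCovers (PixleyRoy X)) (openCovers (PixleyRoy X))) ∧
      (SelFin (omegaCovers X) (omegaCovers X) → ¬ SelOne (omegaCovers X) (omegaCovers X) →
        ¬ SelFin (denseFamilies (PixleyRoy X)) (denseFamilies (PixleyRoy X)) ∧
        SelFin (denseOpenFamilies (PixleyRoy X)) (denseFamilies (PixleyRoy X)) ∧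
        SelFin (openCovers (PixleyRoy X)) (denseFamilies (PixleyRoy X)) ∧
        ¬ SelFin (openCovers (PixleyRoy X)) (openCovers (PixleyRoy X)) ∧
        ¬ SelOne (denseFamilies (PixleyRoy X)) (denseFamilies (PixleyRoy X)) ∧
        ¬ SelOne (denseOpenFamilies (PixleyRoy X)) (denseFamilies (PixleyRoy X)) ∧
        ¬ SelOne (openCovers (PixleyRoy X)) (denseFamilies (PixleyRoy X)) ∧
        ¬ SelOne (openCovers (PixleyRoy X)) (openCovers (PixleyRoy X)))) ∧
    SelFin (omegaCovers ℝ) (omegaCovers ℝ) ∧ ¬ SelOne (omegaCovers ℝ) (omegaCovers ℝ) := by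
  refine ⟨fun X _ _ _ _ => ?_, selFin_omegaCovers_real, not_selOne_omegaCovers_real⟩
  have hDD := PixleyRoy.not_selFin_denseFamilies (X := X)
  have hOO := PixleyRoy.not_selFin_openCovers (X := X)
  have hsub := openCovers_subset_denseOpenFamilies (PixleyRoy X)
  have hfin_up : SelFin (omegaCovers X) (omegaCovers X) →
      SelFin (denseOpenFamilies (PixleyRoy X)) (denseFamilies (PixleyRoy X)) :=
    SelSize.denseOpenFamilies_of_omegaCovers isSizeNotion_finite
  have hfin_mono : SelFin (denseOpenFamilies (PixleyRoy X)) (denseFamilies (PixleyRoy X)) →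
      SelFin (openCovers (PixleyRoy X)) (denseFamilies (PixleyRoy X)) :=
    fun h => SelSize.mono_left (p := fun _ s => s.Finite) h hsub
  have hfin_down : SelFin (openCovers (PixleyRoy X)) (denseFamilies (PixleyRoy X)) →
      SelFin (omegaCovers X) (omegaCovers X) :=
    SelSize.omegaCovers_of_openCovers isSizeNotion_finite
  have hone_up : SelOne (omegaCovers X) (omegaCovers X) →
      SelOne (denseOpenFamilies (PixleyRoy X)) (denseFamilies (PixleyRoy X)) := by
    simp only [selOne_iff_selSize]
    exact SelSize.denseOpenFamilies_of_omegaCovers isSizeNotion_singleton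
  have hone_mono : SelOne (denseOpenFamilies (PixleyRoy X)) (denseFamilies (PixleyRoy X)) →
      SelOne (openCovers (PixleyRoy X)) (denseFamilies (PixleyRoy X)) := by
    simp only [selOne_iff_selSize]
    exact fun h => h.mono_left hsub
  have hone_down : SelOne (openCovers (PixleyRoy X)) (denseFamilies (PixleyRoy X)) →
      SelOne (omegaCovers X) (omegaCovers X) := by
    simp only [selOne_iff_selSize]
    exact SelSize.omegaCovers_of_openCovers isSizeNotion_singleton
  refine ⟨fun h1 => ?_, fun hf => ?_, fun hf h1 => ?_⟩
  · have h2 := hone_up h1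
    exact ⟨hDD, h2.selFin, hfin_mono h2.selFin, hOO, fun h => hDD h.selFin, h2, hone_mono h2,
      fun h => hOO h.selFin⟩
  · exact ⟨hDD, fun h => hf (hfin_down (hfin_mono h)), fun h => hf (hfin_down h), hOO,
      fun h => hDD h.selFin, fun h => hf (hone_down (hone_mono h)).selFin,
      fun h => hf (hone_down h).selFin, fun h => hOO h.selFin⟩
  · have h2 := hfin_up hf
    exact ⟨hDD, h2, hfin_mono h2, hOO, fun h => hDD h.selFin, fun h => h1 (hone_down (hone_mono h)),
      fun h => h1 (hone_down h), fun h => hOO h.selFin⟩
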